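/- For integers $m,n\ge 1$ let $M_m(n)=\sum_{k\ge1}k^m F_k(n)$ be the $m$-th frequency moment, where $F_k(n)$ is the total number of parts of size $k$ across all partitions of $n$. For $\tau$ in the upper half-plane put $q=e^{2\pi i\tau}$ and $q^{-1/24}=e^{-2\pi i\tau/24}$. Let $\eta(\tau)=e^{2\pi i\tau/24}\prod_{r\ge1}(1-q^r)$ be the Dedekind eta function and $j=E_4^3/\Delta$ the modular $j$-invariant, where $E_4$ is the level-one Eisenstein series of weight $4$ with constant term $1$ and $\Delta=\eta^{24}$. Then for every $\tau$ in the upper half-plane the series $\sum_{n\ge1}M_{11}(n)q^n$ converges absolutely, and $$ j(\tau)=\frac{65520}{691}\,q^{-1/24}\Big(\sum_{n\ge1}M_{11}(n)q^n\Big)\,\eta(\tau)^{-23}+\eta(\tau)^{-24}+\frac{432000}{691}. $$ -/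

import Mathlib

noncomputable section

/-- `F_k(n)`: the total number of parts of size `k` across all partitions of `n`. -/
def partFrequency (k n : ℕ) : ℕ :=
  ∑ P : n.Partition, P.parts.count k

/-- The `m`-th frequency moment `M_m(n) = ∑_{k ≥ 1} k ^ m * F_k(n)`; the terms with `k > n` vanish
(see `partFrequency_eq_zero`), so the sum is taken over `1 ≤ k ≤ n`. -/
def frequencyMoment (m n : ℕ) : ℕ :=
  ∑ k ∈ Finset.Icc 1 n, k ^ m * partFrequency k n

theorem partFrequency_eq_zero {k n : ℕ} (h : n < k) : partFrequency k n = 0 := by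
  refine Finset.sum_eq_zero fun P _ => Multiset.count_eq_zero.2 fun hk => ?_
  exact absurd (Nat.Partition.le_of_mem_parts hk) (not_le.2 h)

/-- `M_m(n)` is the sum of the `m`-th powers of all parts of all partitions of `n`. -/
theorem frequencyMoment_eq_sum_parts (m n : ℕ) :
    frequencyMoment m n = ∑ P : n.Partition, (P.parts.map (fun i => i ^ m)).sum := by
  simp only [frequencyMoment, partFrequency, Finset.mul_sum]
  rw [Finset.sum_comm]
  refine Finset.sum_congr rfl fun P _ => ?_
  rw [Finset.sum_multiset_map_count]
  simp only [smul_eq_mul]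
  rw [← Finset.sum_subset (s₁ := P.parts.toFinset)]
  · exact Finset.sum_congr rfl fun i _ => mul_comm _ _
  · intro i hi
    have h := Multiset.mem_toFinset.1 hi
    exact Finset.mem_Icc.2 ⟨P.parts_pos h, Nat.Partition.le_of_mem_parts h⟩
  · intro i _ hi
    rw [Multiset.count_eq_zero.2 (fun h => hi (Multiset.mem_toFinset.2 h)), mul_zero]

/-- The modular `j`-invariant `j = E₄ ^ 3 / Δ`, with `E₄` the Eisenstein series of weight `4` and
level `1` with constant term `1`, and `Δ = η ^ 24`. -/
def kleinJ (τ : UpperHalfPlane) : ℂ :=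
  ModularForm.E₄ τ ^ 3 / ModularForm.discriminant τ

end

/-! Counting the parts equal to `k` by "at least `j` copies of `k`" shows that `M_m` is the
convolution of the partition numbers with `σ_m`. By Euler's product, `∑ M₁₁(n) qⁿ` is therefore `∑
σ₁₁(n) qⁿ` divided by `∏ (1 - q^r)`, and the factor `q^(-1/24)` turns that product into `η`. As `E₁₂
= 1 + (65520/691) ∑ σ₁₁(n) qⁿ`, the first two terms on the right are `E₁₂ / Δ`. What remains is `E₄³
= E₁₂ + (432000/691) Δ`, which holds because weight 12 cusp forms of level one are multiples of `Δ`.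
-/

/-! ### The weight 12 identity. -/

open ModularForm EisensteinSeries UpperHalfPlane MatrixGroups in
theorem E₄_cube_eq_E_twelve_add_discriminant (z : UpperHalfPlane) :
    E₄ z ^ 3 = E (k := 12) (by norm_num) z + 432000 / 691 * discriminant z := by
  set E₁₂ : ModularForm 𝒮ℒ 12 := E (k := 12) (by norm_num) with hE₁₂
  let F : ModularForm 𝒮ℒ 12 := ModularForm.mcast (by decide) (E₄.pow 3) - E₁₂
  have hq : qExpansion 1 F = qExpansion 1 E₄ * qExpansion 1 E₄ * qExpansion 1 E₄ -
      qExpansion 1 E₁₂ := by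
    simp only [F, FunLike.coe_sub, coe_mcast,
      ModularForm.qExpansion_sub one_pos one_mem_strictPeriods_SL,
      ModularForm.qExpansion_pow one_pos one_mem_strictPeriods_SL]
    ring
  have h0 : (qExpansion 1 E₁₂).coeff 0 = 1 := E_qExpansion_coeff_zero _ ⟨6, rfl⟩
  -- The coefficient is `-24 / B₁₂` with `B₁₂ = -691/2730`.
  have h1 : (qExpansion 1 E₁₂).coeff 1 = 65520 / 691 := by
    have := E_qExpansion_coeff (k := 12) (by norm_num) ⟨6, rfl⟩ 1
    norm_num [show bernoulli 12 = -691 / 2730 by decide +kernel] at this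
    exact this
  have hcusp : IsCuspForm F := by
    rw [isCuspForm_iff_coeffZero_eq_zero, hq]
    simp only [map_sub, h0]
    simp [PowerSeries.coeff_mul, -PowerSeries.coeff_zero_eq_constantCoeff,
      E_qExpansion_coeff_zero _ ⟨2, rfl⟩]
  -- `E₄ = 1 + 240 q + ⋯`, so the value is `3 * 240 - 65520/691`.
  have hF1 : (qExpansion 1 F).coeff 1 = 432000 / 691 := by
    rw [hq, map_sub, h1]
    norm_num [PowerSeries.coeff_mul, Finset.Nat.antidiagonal_succ, E₄_qExpansion_coeff_one,
      E_qExpansion_coeff_zero _ ⟨2, rfl⟩]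
  obtain ⟨g, hg⟩ := hcusp
  obtain ⟨c, hc⟩ := CuspForm.exists_smul_discriminant_of_weight_eq_twelve g
  have hgF : (g : UpperHalfPlane → ℂ) = F := congrArg DFunLike.coe hg
  have hcΔ : (c • CuspForm.discriminant : UpperHalfPlane → ℂ) = g := congrArg DFunLike.coe hc
  have hc_eq : c = 432000 / 691 := by
    have hgΔ := ModularForm.qExpansion_smul one_pos one_mem_strictPeriods_SL c
      CuspForm.discriminant
    rw [hcΔ, hgF] at hgΔ
    simpa [PowerSeries.coeff_smul, discriminant_qExpansion_coeff_one, hF1]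
      using (congr_arg (·.coeff 1) hgΔ).symm
  have hz : F z = c * discriminant z := (congrFun (hcΔ.trans hgF) z).symm
  have hFz : F z = E₄ z ^ 3 - E₁₂ z := by
    simp only [F, coe_mcast, coe_pow, sub_apply, Pi.pow_apply]
  rw [← hc_eq, ← hz, hFz]
  ring

/-! ### Moments as a convolution. -/

/-- Removing `j` copies of `k` is a bijection from the partitions of `n` in which `k` occurs at
least `j` times onto the partitions of `n - j * k`. -/
theorem card_filter_le_count_parts {k j n : ℕ} (hk : 0 < k) (h : j * k ≤ n) :
    (Finset.univ.filter fun P : n.Partition => j ≤ P.parts.count k).card =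
      Fintype.card (n - j * k).Partition := by
  rw [← Finset.card_univ]
  refine Finset.card_bij'
    (fun P hP => ⟨P.parts - Multiset.replicate j k,
      fun hi => P.parts_pos (Multiset.mem_of_le (Multiset.sub_le_self _ _) hi), ?_⟩)
    (fun Q _ => ⟨Q.parts + Multiset.replicate j k, fun {i} hi => ?_, ?_⟩)
    (fun _ _ => Finset.mem_univ _) (fun Q _ => ?_) (fun P hP => ?_) (fun Q _ => ?_)
  · have hle := Multiset.le_count_iff_replicate_le.1 (Finset.mem_filter.1 hP).2
    have hs := congrArg Multiset.sum (Multiset.sub_add_cancel hle)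
    simp only [Multiset.sum_add, Multiset.sum_replicate, P.parts_sum, smul_eq_mul] at hs
    omega
  · rcases Multiset.mem_add.1 hi with hi | hi
    · exact Q.parts_pos hi
    · rwa [Multiset.eq_of_mem_replicate hi]
  · simp only [Multiset.sum_add, Multiset.sum_replicate, Q.parts_sum, smul_eq_mul]
    omega
  · simp
  · have hle := Multiset.le_count_iff_replicate_le.1 (Finset.mem_filter.1 hP).2
    exact Nat.Partition.ext (Multiset.sub_add_cancel hle)
  · exact Nat.Partition.ext (Multiset.add_sub_cancel_right)

/-- A multiplicity is the number of `j ≥ 1` not exceeding it; interchange the sums over `P` and `j`.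
-/
theorem partFrequency_eq_sum_card {k : ℕ} (hk : 0 < k) (n : ℕ) :
    partFrequency k n =
      ∑ j ∈ Finset.Icc 1 n, if k * j ≤ n then Fintype.card (n - k * j).Partition else 0 := by
  have hcount (P : n.Partition) :
      P.parts.count k = ∑ j ∈ Finset.Icc 1 n, if j ≤ P.parts.count k then 1 else 0 := by
    have hle : P.parts.count k ≤ n := by
      have hr := Multiset.le_count_iff_replicate_le.1 (le_refl (P.parts.count k))
      obtain ⟨t, ht⟩ := Multiset.le_iff_exists_add.1 hr
      have hs := congrArg Multiset.sum ht
      simp only [Multiset.sum_add, Multiset.sum_replicate, P.parts_sum, smul_eq_mul] at hs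
      have hmul := Nat.le_mul_of_pos_right (P.parts.count k) hk
      omega
    rw [← Finset.card_filter,
      show (Finset.Icc 1 n).filter (· ≤ P.parts.count k) = Finset.Icc 1 (P.parts.count k) by
        ext j; simp only [Finset.mem_filter, Finset.mem_Icc]; omega]
    simp
  rw [partFrequency, Finset.sum_congr rfl fun P _ => hcount P, Finset.sum_comm]
  refine Finset.sum_congr rfl fun j _ => ?_
  rw [← Finset.card_filter]
  split_ifs with h
  · rw [card_filter_le_count_parts hk (by rwa [mul_comm]), mul_comm]
  · refine Finset.card_eq_zero.2 (Finset.filter_eq_empty_iff.2 fun P _ hj => h ?_)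
    obtain ⟨t, ht⟩ := Multiset.le_iff_exists_add.1 (Multiset.le_count_iff_replicate_le.1 hj)
    have hs := congrArg Multiset.sum ht
    simp only [Multiset.sum_add, Multiset.sum_replicate, P.parts_sum, smul_eq_mul] at hs
    rw [mul_comm]
    omega

/-- The box for `(k, j)` does not depend on `b`, so the sums can be interchanged in the convolution.
-/
theorem sigma_eq_sum_ite {m b n : ℕ} (hb : b ≤ n) :
    ArithmeticFunction.sigma m b =
      ∑ k ∈ Finset.Icc 1 n, ∑ j ∈ Finset.Icc 1 n, if k * j = b then k ^ m else 0 := by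
  rw [ArithmeticFunction.sigma_apply,
    ← Nat.sum_divisorsAntidiagonal (fun k _ => k ^ m), ← Finset.sum_product',
    ← Finset.sum_filter]
  refine Finset.sum_congr ?_ fun _ _ => rfl
  ext ⟨k, j⟩
  simp only [Nat.mem_divisorsAntidiagonal, Finset.mem_filter, Finset.mem_product, Finset.mem_Icc]
  constructor
  · rintro ⟨rfl, h⟩
    have hk : 0 < k := Nat.pos_of_ne_zero fun h0 => h (by simp [h0])
    have hj : 0 < j := Nat.pos_of_ne_zero fun h0 => h (by simp [h0])
    exact ⟨⟨⟨hk, by nlinarith⟩, hj, by nlinarith⟩, rfl⟩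
  · rintro ⟨⟨⟨hk, _⟩, hj, _⟩, rfl⟩
    exact ⟨rfl, by positivity⟩

/-- The frequency moments are the convolution of the partition numbers with `σ_m`. -/
theorem frequencyMoment_eq_sum_antidiagonal (m n : ℕ) :
    frequencyMoment m n = ∑ x ∈ Finset.HasAntidiagonal.antidiagonal n,
      Fintype.card x.1.Partition * ArithmeticFunction.sigma m x.2 := by
  rw [Finset.Nat.sum_antidiagonal_eq_sum_range_succ_mk, ← Finset.sum_range_reflect]
  have hsummand : ∀ b ∈ Finset.range (n + 1),
      Fintype.card (n + 1 - 1 - b).Partition * ArithmeticFunction.sigma m (n - (n + 1 - 1 - b)) =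
      ∑ k ∈ Finset.Icc 1 n, ∑ j ∈ Finset.Icc 1 n,
        if k * j = b then k ^ m * Fintype.card (n - b).Partition else 0 := by
    intro b hb
    have hb' : b ≤ n := Nat.lt_succ_iff.1 (Finset.mem_range.1 hb)
    rw [Nat.add_sub_cancel, Nat.sub_sub_self hb', sigma_eq_sum_ite hb', mul_comm,
      Finset.sum_mul]
    simp only [Finset.sum_mul, ite_mul, zero_mul]
  rw [Finset.sum_congr rfl hsummand, Finset.sum_comm]
  refine Finset.sum_congr rfl fun k hk => ?_
  rw [Finset.sum_comm, partFrequency_eq_sum_card (Finset.mem_Icc.1 hk).1, Finset.mul_sum]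
  refine Finset.sum_congr rfl fun j _ => ?_
  -- For fixed `k` and `j` only `b = k * j` contributes.
  rw [Finset.sum_ite_eq]
  simp only [Finset.mem_range, Nat.lt_succ_iff, mul_ite, mul_zero]

/-! ### Euler's product, by truncation to parts of size at most `N`. -/

open Filter Topology

open PowerSeries PowerSeries.WithPiTopology Nat.Partition in
/-- The generating function of the partitions into parts of size at most `N`. -/
theorem mk_card_restricted_le_eq_prod (N : ℕ) :
    PowerSeries.mk (fun n => ((restricted n (· ≤ N)).card : ℂ)) =
      ∏ i ∈ Finset.range N, PowerSeries.mk (fun n => if i + 1 ∣ n then (1 : ℂ) else 0) := by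
  rw [powerSeriesMk_card_restricted_eq_tprod ℂ (· ≤ N),
    tprod_eq_prod (s := Finset.range N) fun i hi => if_neg (by simpa using hi)]
  refine Finset.prod_congr rfl fun i hi => ?_
  rw [if_pos (Nat.succ_le_of_lt (Finset.mem_range.1 hi))]
  have hs : Summable fun j : ℕ => (X : ℂ⟦X⟧) ^ ((i + 1) * j) := by
    simp_rw [pow_mul]
    exact summable_pow_of_constantCoeff_eq_zero (by simp)
  ext n
  rw [hs.map_tsum _ (continuous_coeff _ _), coeff_mk]
  simp_rw [coeff_X_pow]
  split_ifs with h
  · obtain ⟨j, rfl⟩ := h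
    rw [tsum_eq_single j fun b hb => if_neg fun h => hb (Nat.eq_of_mul_eq_mul_left i.succ_pos h).symm,
      if_pos rfl]
  · exact (tsum_congr fun j => if_neg fun hj => h ⟨j, hj⟩).trans tsum_zero

open PowerSeries in
-- Cauchy product. Absolute summability is carried along with the value so that finite products
-- follow by induction.
theorem summable_norm_coeff_mul_and_tsum_eq {f g : ℂ⟦X⟧} {q a b : ℂ}
    (hf : Summable (fun n => ‖coeff n f * q ^ n‖) ∧ ∑' n, coeff n f * q ^ n = a)
    (hg : Summable (fun n => ‖coeff n g * q ^ n‖) ∧ ∑' n, coeff n g * q ^ n = b) :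
    Summable (fun n => ‖coeff n (f * g) * q ^ n‖) ∧ ∑' n, coeff n (f * g) * q ^ n = a * b := by
  have h (n : ℕ) : coeff n (f * g) * q ^ n = ∑ x ∈ Finset.HasAntidiagonal.antidiagonal n,
      (coeff x.1 f * q ^ x.1) * (coeff x.2 g * q ^ x.2) := by
    rw [coeff_mul, Finset.sum_mul]
    refine Finset.sum_congr rfl fun x hx => ?_
    rw [mul_mul_mul_comm, ← pow_add, Finset.HasAntidiagonal.mem_antidiagonal.1 hx]
  refine ⟨(summable_norm_sum_mul_antidiagonal_of_summable_norm (f := fun n => coeff n f * q ^ n)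
    (g := fun n => coeff n g * q ^ n) hf.1 hg.1).congr fun n => congrArg norm (h n).symm, ?_⟩
  rw [tsum_congr h, ← hf.2, ← hg.2]
  exact (tsum_mul_tsum_eq_tsum_sum_antidiagonal_of_summable_norm
    (f := fun n => coeff n f * q ^ n) (g := fun n => coeff n g * q ^ n) hf.1 hg.1).symm

open PowerSeries in
theorem summable_norm_coeff_prod_and_tsum_eq {ι : Type*} (s : Finset ι) {f : ι → ℂ⟦X⟧} {q : ℂ}
    {a : ι → ℂ} (h : ∀ i ∈ s, Summable (fun n => ‖coeff n (f i) * q ^ n‖) ∧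
      ∑' n, coeff n (f i) * q ^ n = a i) :
    Summable (fun n => ‖coeff n (∏ i ∈ s, f i) * q ^ n‖) ∧
      ∑' n, coeff n (∏ i ∈ s, f i) * q ^ n = ∏ i ∈ s, a i := by
  classical
  induction s using Finset.induction_on with
  | empty =>
    have h1 (n : ℕ) : coeff n (1 : ℂ⟦X⟧) * q ^ n = if n = 0 then 1 else 0 := by
      rw [coeff_one]; split_ifs with hn <;> simp [hn]
    simp only [Finset.prod_empty, h1, tsum_ite_eq, and_true]
    refine summable_of_ne_finset_zero (s := {0}) fun n hn => ?_
    simp [Finset.notMem_singleton.1 hn]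
  | insert i s hi ih =>
    rw [Finset.prod_insert hi, Finset.prod_insert hi]
    exact summable_norm_coeff_mul_and_tsum_eq (h i (Finset.mem_insert_self i s))
      (ih fun j hj => h j (Finset.mem_insert_of_mem hj))

theorem hasSum_ite_dvd_mul_pow {K : Type*} [NormedDivisionRing K] {d : ℕ} (hd : 0 < d) {q : K}
    (hq : ‖q‖ < 1) :
    HasSum (fun n : ℕ => (if d ∣ n then (1 : K) else 0) * q ^ n) (1 - q ^ d)⁻¹ := by
  have hinj : Function.Injective (d * ·) := fun a b h => Nat.eq_of_mul_eq_mul_left hd h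
  rw [← hinj.hasSum_iff]
  · have hqd : ‖q ^ d‖ < 1 := by
      rw [norm_pow]; exact pow_lt_one₀ (norm_nonneg _) hq hd.ne'
    convert! hasSum_geometric_of_norm_lt_one hqd using 1
    ext j
    simp [pow_mul]
  · intro n hn
    rw [if_neg fun ⟨j, hj⟩ => hn ⟨j, hj.symm⟩, zero_mul]

open Nat.Partition in
theorem summable_norm_card_restricted_le_and_tsum_eq (N : ℕ) {q : ℂ} (hq : ‖q‖ < 1) :
    Summable (fun n => ‖((restricted n (· ≤ N)).card : ℂ) * q ^ n‖) ∧
      ∑' n, ((restricted n (· ≤ N)).card : ℂ) * q ^ n =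
        ∏ i ∈ Finset.range N, (1 - q ^ (i + 1))⁻¹ := by
  have h := summable_norm_coeff_prod_and_tsum_eq (q := q) (Finset.range N)
    (f := fun i => PowerSeries.mk (fun n => if i + 1 ∣ n then (1 : ℂ) else 0))
    (a := fun i => (1 - q ^ (i + 1))⁻¹) fun i _ => by
      simp only [PowerSeries.coeff_mk]
      refine ⟨?_, (hasSum_ite_dvd_mul_pow i.succ_pos hq).tsum_eq⟩
      refine (hasSum_ite_dvd_mul_pow i.succ_pos (q := ‖q‖) (by simpa)).summable.congr fun n => ?_
      split_ifs <;> simp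
  rw [← mk_card_restricted_le_eq_prod] at h
  simpa only [PowerSeries.coeff_mk] using h

theorem tprod_one_sub_pow_ne_zero {q : ℂ} (hq : ‖q‖ < 1) : ∏' n : ℕ, (1 - q ^ (n + 1)) ≠ 0 := by
  simp_rw [sub_eq_add_neg]
  refine tprod_one_add_ne_zero_of_summable (f := fun n : ℕ => -q ^ (n + 1)) (fun i h => ?_) ?_
  · have h1 : ‖q ^ (i + 1)‖ < 1 := by
      rw [norm_pow]; exact pow_lt_one₀ (norm_nonneg _) hq i.succ_ne_zero
    rw [← sub_eq_add_neg, sub_eq_zero] at h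
    rw [← h, norm_one] at h1
    exact lt_irrefl _ h1
  · simpa using (summable_nat_add_iff 1).mpr (summable_geometric_of_lt_one (norm_nonneg _) hq)

theorem tendsto_prod_inv_one_sub_pow {q : ℂ} (hq : ‖q‖ < 1) :
    Tendsto (fun N => ∏ i ∈ Finset.range N, (1 - q ^ (i + 1))⁻¹) atTop
      (𝓝 (∏' n : ℕ, (1 - q ^ (n + 1)))⁻¹) := by
  simp_rw [Finset.prod_inv_distrib]
  exact (ModularForm.multipliable_one_sub_pow hq).hasProd.tendsto_prod_nat.inv₀
    (tprod_one_sub_pow_ne_zero hq)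

theorem Nat.Partition.card_restricted_le_of_le {n N : ℕ} (h : n ≤ N) :
    (Nat.Partition.restricted n (· ≤ N)).card = Fintype.card n.Partition := by
  rw [← Finset.card_univ]
  congr 1
  exact Finset.filter_true_of_mem fun P _ i hi => (Nat.Partition.le_of_mem_parts hi).trans h

/-- At the real point `‖q‖`, the first `N` terms agree with those of the series restricted to parts
at most `N`. Its value is a finite product, bounded in `N` because these products converge. -/
theorem summable_norm_card_partition_mul_pow {q : ℂ} (hq : ‖q‖ < 1) :
    Summable fun n : ℕ => ‖(Fintype.card n.Partition : ℂ) * q ^ n‖ := by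
  have hx : ‖(‖q‖ : ℂ)‖ < 1 := by simpa
  obtain ⟨C, hC⟩ := (tendsto_prod_inv_one_sub_pow hx).norm.bddAbove_range
  refine summable_of_sum_range_le (c := C) (fun _ => norm_nonneg _) fun N => ?_
  obtain ⟨hs, ht⟩ := summable_norm_card_restricted_le_and_tsum_eq N hx
  refine le_trans ?_ (hC ⟨N, rfl⟩)
  dsimp only
  rw [← ht]
  have hreal (n : ℕ) : ((Nat.Partition.restricted n (· ≤ N)).card : ℂ) * (‖q‖ : ℂ) ^ n =
      ((‖((Nat.Partition.restricted n (· ≤ N)).card : ℂ) * (‖q‖ : ℂ) ^ n‖ : ℝ) : ℂ) := by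
    simp
  rw [tsum_congr hreal, ← Complex.ofReal_tsum, Complex.norm_real]
  refine le_trans ?_ (le_abs_self _)
  refine le_trans (Finset.sum_le_sum fun n hn => ?_)
    (hs.sum_le_tsum (Finset.range N) fun _ _ => norm_nonneg _)
  rw [Nat.Partition.card_restricted_le_of_le (Finset.mem_range.1 hn).le]
  simp

/-- Euler's product for the generating function of the partition numbers. -/
theorem tsum_card_partition_mul_pow {q : ℂ} (hq : ‖q‖ < 1) :
    ∑' n : ℕ, (Fintype.card n.Partition : ℂ) * q ^ n = (∏' n : ℕ, (1 - q ^ (n + 1)))⁻¹ := by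
  refine tendsto_nhds_unique (tendsto_tsum_of_dominated_convergence
    (f := fun N n => ((Nat.Partition.restricted n (· ≤ N)).card : ℂ) * q ^ n)
    (summable_norm_card_partition_mul_pow hq) (fun n => ?_) (.of_forall fun N n => ?_))
    ((tendsto_prod_inv_one_sub_pow hq).congr fun N =>
      (summable_norm_card_restricted_le_and_tsum_eq N hq).2.symm)
  · refine tendsto_const_nhds.congr' ?_
    filter_upwards [eventually_ge_atTop n] with N hN
    rw [Nat.Partition.card_restricted_le_of_le hN]
  · simp only [norm_mul, Complex.norm_natCast]
    gcongr
    rw [← Finset.card_univ]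
    exact Finset.card_filter_le _ _

/-! ### Generating function of the moments and conclusion. -/

theorem summable_norm_sigma_mul_pow (m : ℕ) {q : ℂ} (hq : ‖q‖ < 1) :
    Summable fun n : ℕ => ‖(ArithmeticFunction.sigma m n : ℂ) * q ^ n‖ := by
  refine (summable_norm_pow_mul_geometric_of_norm_lt_one (m + 1) hq).of_nonneg_of_le
    (fun _ => norm_nonneg _) fun n => ?_
  simp only [norm_mul, Complex.norm_natCast, norm_pow]
  gcongr
  exact_mod_cast ArithmeticFunction.sigma_le_pow_succ m n

theorem frequencyMoment_mul_pow_eq_sum_antidiagonal (m n : ℕ) (q : ℂ) :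
    (frequencyMoment m n : ℂ) * q ^ n = ∑ x ∈ Finset.HasAntidiagonal.antidiagonal n,
      ((Fintype.card x.1.Partition : ℂ) * q ^ x.1) *
        ((ArithmeticFunction.sigma m x.2 : ℂ) * q ^ x.2) := by
  rw [frequencyMoment_eq_sum_antidiagonal, Nat.cast_sum, Finset.sum_mul]
  refine Finset.sum_congr rfl fun x hx => ?_
  rw [← Finset.HasAntidiagonal.mem_antidiagonal.1 hx, pow_add]
  push_cast
  ring

theorem summable_frequencyMoment_mul_pow (m : ℕ) {q : ℂ} (hq : ‖q‖ < 1) :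
    Summable fun n : ℕ => (frequencyMoment m n : ℂ) * q ^ n := by
  simp_rw [frequencyMoment_mul_pow_eq_sum_antidiagonal]
  exact (summable_norm_sum_mul_antidiagonal_of_summable_norm
    (summable_norm_card_partition_mul_pow hq) (summable_norm_sigma_mul_pow m hq)).of_norm

/-- The generating function of the frequency moments. -/
theorem tsum_frequencyMoment_mul_pow (m : ℕ) {q : ℂ} (hq : ‖q‖ < 1) :
    ∑' n : ℕ+, (frequencyMoment m n : ℂ) * q ^ (n : ℕ) =
      (∏' n : ℕ, (1 - q ^ (n + 1)))⁻¹ *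
        ∑' n : ℕ+, (ArithmeticFunction.sigma m n : ℂ) * q ^ (n : ℕ) := by
  have hM := tsum_zero_pnat_eq_tsum_nat (summable_frequencyMoment_mul_pow m hq)
  have hσ := tsum_zero_pnat_eq_tsum_nat (summable_norm_sigma_mul_pow m hq).of_norm
  -- Both terms at `n = 0` vanish (`σ_m(0) = 0` by convention), so the sums extend to `ℕ`, where the
  -- Cauchy product applies.
  have hM0 : frequencyMoment m 0 = 0 := Finset.sum_empty
  simp only [hM0, ArithmeticFunction.map_zero, Nat.cast_zero, zero_mul, zero_add] at hM hσ
  rw [hM, hσ, ← tsum_card_partition_mul_pow hq,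
    tsum_mul_tsum_eq_tsum_sum_antidiagonal_of_summable_norm
      (summable_norm_card_partition_mul_pow hq) (summable_norm_sigma_mul_pow m hq)]
  exact tsum_congr fun n => frequencyMoment_mul_pow_eq_sum_antidiagonal m n q

open EisensteinSeries in
theorem E_twelve_eq_one_add_tsum_sigma (z : UpperHalfPlane) :
    ModularForm.E (k := 12) (by norm_num) z = 1 + 65520 / 691 *
      ∑' n : ℕ+, (ArithmeticFunction.sigma 11 n : ℂ) *
        Complex.exp (2 * Real.pi * Complex.I * (z : ℂ)) ^ (n : ℕ) := by
  rw [q_expansion_bernoulli (by norm_num) ⟨6, rfl⟩]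
  norm_num [show bernoulli 12 = -691 / 2730 by decide +kernel]

theorem mainTheorem6 (τ : UpperHalfPlane) :
    Summable (fun n : ℕ+ =>
        (frequencyMoment 11 n : ℂ) * Complex.exp (2 * Real.pi * Complex.I * (τ : ℂ)) ^ (n : ℕ)) ∧
      kleinJ τ =
        (65520 / 691 : ℂ) * Complex.exp (-(2 * Real.pi * Complex.I * (τ : ℂ) / 24)) *
            (∑' n : ℕ+, (frequencyMoment 11 n : ℂ) *
              Complex.exp (2 * Real.pi * Complex.I * (τ : ℂ)) ^ (n : ℕ)) *
            ModularForm.eta (τ : ℂ) ^ (-23 : ℤ) +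
          ModularForm.eta (τ : ℂ) ^ (-24 : ℤ) +
          (432000 / 691 : ℂ) := by
  have hq : ‖Complex.exp (2 * Real.pi * Complex.I * (τ : ℂ))‖ < 1 :=
    UpperHalfPlane.norm_exp_two_pi_I_lt_one τ
  refine ⟨(summable_frequencyMoment_mul_pow 11 hq).comp_injective PNat.coe_injective, ?_⟩
  have hη : ModularForm.eta (τ : ℂ) ≠ 0 := ModularForm.eta_ne_zero τ.2
  have hηP : ModularForm.eta (τ : ℂ) = Complex.exp (2 * Real.pi * Complex.I * (τ : ℂ) / 24) *
      ∏' n : ℕ, (1 - Complex.exp (2 * Real.pi * Complex.I * (τ : ℂ)) ^ (n + 1)) := by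
    simp only [ModularForm.eta, ModularForm.eta_q_eq_pow, Function.Periodic.qParam,
      Complex.ofReal_ofNat]
  have hinv : Complex.exp (-(2 * Real.pi * Complex.I * (τ : ℂ) / 24)) *
      (∏' n : ℕ, (1 - Complex.exp (2 * Real.pi * Complex.I * (τ : ℂ)) ^ (n + 1)))⁻¹ =
      (ModularForm.eta (τ : ℂ))⁻¹ := by
    rw [hηP, Complex.exp_neg, mul_inv]
  rw [tsum_frequencyMoment_mul_pow 11 hq, kleinJ, E₄_cube_eq_E_twelve_add_discriminant,
    E_twelve_eq_one_add_tsum_sigma, ModularForm.discriminant]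
  -- Only algebra remains: `c * P = e⁻¹` and `Δ = e ^ 24`.
  generalize Complex.exp (-(2 * Real.pi * Complex.I * (τ : ℂ) / 24)) = c at hinv ⊢
  generalize (∏' n : ℕ, (1 - Complex.exp (2 * Real.pi * Complex.I * (τ : ℂ)) ^ (n + 1)))⁻¹ = P
    at hinv ⊢
  generalize ModularForm.eta (τ : ℂ) = e at hη hinv ⊢
  generalize (∑' n : ℕ+, (ArithmeticFunction.sigma 11 n : ℂ) *
    Complex.exp (2 * Real.pi * Complex.I * (τ : ℂ)) ^ (n : ℕ)) = S
  rw [show (65520 / 691 : ℂ) * c * (P * S) = 65520 / 691 * (c * P) * S by ring, hinv]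
  field_simp
  ring
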